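/- **Definitions.** Let $G$ be a group and $S\subseteq G$ a generating set. The Cayley graph $\Gamma_S(G)$ is the 1-complex with vertex set $G$ and edge set $G\times S$, where the edge $(g,s)$ joins $g$ to $gs$; it is a metric space with the combinatorial metric, in which every edge has length $1$. A geodesic metric space is *hyperbolic* if there is $\delta\ge 0$ such that in every geodesic triangle each side is contained in the closed $\delta$-neighborhood of the union of the other two sides. Let $\mathcal H=\{H_1,\dots,H_m\}$ be a collection of subgroups of $G$. We say that $G$ is *weakly hyperbolic relative to* $\mathcal H$ if there is a finite subset $X\subseteq G$ such that $X\cup H_1\cup\dots\cup H_m$ generates $G$ and the Cayley graph of $G$ with respect to the generating set $X\cup H_1\cup\dots\cup H_m$ is hyperbolic. Weakly hyperbolic relative to a subgroup $P$ means weakly hyperbolic relative to $\{P\}$. **Theorem 1.2.** Let $H$ and $K$ be arbitrary groups, $A\le H$ and $B\le K$ subgroups, and $\mu:A\to B$ an isomorphism. Let $G=H\ast_{A=B}K$ be the amalgamated free product, i.e. the quotient of the free product $H\ast K$ by the relations $a=\mu(a)$, $a\in A$. Identify $H$, $K$ and $A$ with their canonical images in $G$. 1. $G$ is weakly hyperbolic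 relative to $\{H,K\}$. 2. If $H$ is weakly hyperbolic relative to $A$ and $K$ is weakly hyperbolic relative to $B$, then $G$ is weakly hyperbolic relative to $A$. -/

import Mathlib

/-- `P` is a geodesic segment from `x` to `y`: the image of an isometric embedding of a compact
interval `[0, ℓ]` that sends `0` to `x` and `ℓ` to `y`. -/
def IsGeodesicSegment {M : Type*} [MetricSpace M] (P : Set M) (x y : M) : Prop :=
  ∃ (ℓ : ℝ) (γ : ℝ → M), 0 ≤ ℓ ∧ γ 0 = x ∧ γ ℓ = y ∧
    (∀ s ∈ Set.Icc 0 ℓ, ∀ t ∈ Set.Icc 0 ℓ, dist (γ s) (γ t) = |s - t|) ∧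
    P = γ '' Set.Icc 0 ℓ

/-- A geodesic metric space: any two points are joined by a geodesic segment. -/
def IsGeodesicMetricSpace (M : Type*) [MetricSpace M] : Prop :=
  ∀ x y : M, ∃ P : Set M, IsGeodesicSegment P x y

/-- A hyperbolic metric space: a geodesic metric space with a `δ ≥ 0` such that in each geodesic
triangle every side lies in the closed `δ`-neighbourhood of the union of the other two. (By the
cyclic symmetry of the condition it is enough to name one side.) -/
def IsHyperbolicMetricSpace (M : Type*) [MetricSpace M] : Prop :=
  IsGeodesicMetricSpace M ∧
    ∃ δ : ℝ, 0 ≤ δ ∧ ∀ (x y z : M) (P Q R : Set M),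
      IsGeodesicSegment P x y → IsGeodesicSegment Q y z → IsGeodesicSegment R z x →
        ∀ p ∈ P, ∃ q ∈ Q ∪ R, dist p q ≤ δ

section CayleyComplex

variable {G : Type*} [Group G]

theorem mulCayley_connected_of_closure_eq_top {S : Set G} (hS : Subgroup.closure S = ⊤) :
    (SimpleGraph.mulCayley S).Connected := by
  have step : ∀ u s : G, s ∈ S → (SimpleGraph.mulCayley S).Reachable u (u * s) := by
    intro u s hs
    by_cases h : u = u * s
    · rw [← h]
    · exact SimpleGraph.Adj.reachable
        ((SimpleGraph.mulCayley_adj' S u (u * s)).2 ⟨h, s, hs, Or.inl rfl⟩)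
  have key : ∀ g : G, ∀ u : G, (SimpleGraph.mulCayley S).Reachable u (u * g) := by
    intro g
    have hg : g ∈ Subgroup.closure S := by rw [hS]; trivial
    induction hg using Subgroup.closure_induction with
    | mem x hx => exact fun u => step u x hx
    | one => intro u; rw [mul_one]
    | mul x y _ _ ihx ihy => intro u; rw [← mul_assoc]; exact (ihx u).trans (ihy (u * x))
    | inv x _ ih => intro u; simpa using (ih (u * x⁻¹)).symm
  exact { preconnected := fun u v => by simpa using key (u⁻¹ * v) u
          nonempty := ⟨1⟩ }

/-- The combinatorial distance of two vertices in the Cayley graph of `G` with respect to `S`. -/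
noncomputable def cayleyVertexDist (S : Set G) (u v : G) : ℝ :=
  ((SimpleGraph.mulCayley S).dist u v : ℝ)

/-- The pieces from which the Cayley graph of `G` with respect to `S` is glued as a 1-complex: a
point for each vertex `g`, and an interval `[0, 1]` for each edge `(g, s) ∈ G × S`, whose point `0`
is to be glued to the vertex `g` and whose point `1` is to be glued to the vertex `g * s`. The
argument `hS` records that `S` generates `G`. -/
inductive CayleyCell (S : Set G) (hS : Subgroup.closure S = ⊤) : Type _
  | vertex (g : G) : CayleyCell S hS
  | edge (g : G) (s : S) (t : unitInterval) : CayleyCell S hS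

namespace CayleyCell

variable {S : Set G} {hS : Subgroup.closure S = ⊤}

/-- The distance from a point of the complex to a vertex: from a point of an edge, a shortest path
leaves that edge through one of its two ends. -/
noncomputable def distVertex : CayleyCell S hS → G → ℝ
  | .vertex g, v => cayleyVertexDist S g v
  | .edge g s t, v =>
      min ((t : ℝ) + cayleyVertexDist S g v) (1 - (t : ℝ) + cayleyVertexDist S (g * s) v)

open Classical in
/-- The length of a shortest path between two points of the complex, each edge having length `1`:
a path between points of two edges leaves the first edge through one of its ends, or, if the edges
coincide, it may also stay inside the edge. -/
noncomputable def pathDist : CayleyCell S hS → CayleyCell S hS → ℝ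
  | .vertex g, q => distVertex q g
  | .edge g s t, .vertex h => distVertex (.edge g s t : CayleyCell S hS) h
  | .edge g s t, .edge h r u =>
      if g = h ∧ s = r then
        min |(t : ℝ) - (u : ℝ)|
          (min ((t : ℝ) + distVertex (.edge h r u : CayleyCell S hS) g)
            (1 - (t : ℝ) + distVertex (.edge h r u : CayleyCell S hS) (g * s)))
      else
        min ((t : ℝ) + distVertex (.edge h r u : CayleyCell S hS) g)
          (1 - (t : ℝ) + distVertex (.edge h r u : CayleyCell S hS) (g * s))

theorem vertexDist_self (u : G) : cayleyVertexDist S u u = 0 := by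
  simp [cayleyVertexDist]

theorem vertexDist_comm (u v : G) : cayleyVertexDist S u v = cayleyVertexDist S v u := by
  simp [cayleyVertexDist, SimpleGraph.dist_comm]

theorem vertexDist_triangle (hS : Subgroup.closure S = ⊤) (u v w : G) :
    cayleyVertexDist S u w ≤ cayleyVertexDist S u v + cayleyVertexDist S v w := by
  unfold cayleyVertexDist
  exact_mod_cast (mulCayley_connected_of_closure_eq_top hS).dist_triangle

theorem vertexDist_mul_le_one (g : G) (s : S) : cayleyVertexDist S g (g * s) ≤ 1 := by
  by_cases h : g = g * s
  · rw [← h, vertexDist_self]; exact zero_le_one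
  · have := SimpleGraph.dist_eq_one_iff_adj.2
      ((SimpleGraph.mulCayley_adj' S g (g * s)).2 ⟨h, s, s.2, Or.inl rfl⟩)
    simp [cayleyVertexDist, this]

theorem distVertex_le_add (p : CayleyCell S hS) (v w : G) :
    distVertex p v ≤ distVertex p w + cayleyVertexDist S w v := by
  cases p with
  | vertex g => exact vertexDist_triangle hS g w v
  | edge g s t =>
    simp only [distVertex]
    have h1 := vertexDist_triangle hS g w v
    have h2 := vertexDist_triangle hS (g * s) w v
    rcases min_choice ((t : ℝ) + cayleyVertexDist S g w)
      (1 - (t : ℝ) + cayleyVertexDist S (g * s) w) with h | h <;> rw [h]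
    · exact (min_le_left _ _).trans (by linarith)
    · exact (min_le_right _ _).trans (by linarith)

theorem vertexDist_le_add (p : CayleyCell S hS) (v w : G) :
    cayleyVertexDist S v w ≤ distVertex p v + distVertex p w := by
  cases p with
  | vertex g =>
    simp only [distVertex]
    have := vertexDist_triangle hS v g w
    rwa [vertexDist_comm v g] at this
  | edge g s t =>
    simp only [distVertex]
    have t0 := t.2.1
    have t1 := t.2.2
    have e1 := vertexDist_mul_le_one g s
    have e2 := vertexDist_comm (S := S) g (g * s)
    have a1 := vertexDist_triangle hS v g w
    have a2 := vertexDist_triangle hS v (g * s) w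
    have a3 := vertexDist_triangle hS g (g * s) w
    have a4 := vertexDist_triangle hS (g * s) g w
    have c1 := vertexDist_comm (S := S) v g
    have c2 := vertexDist_comm (S := S) v (g * s)
    rcases min_choice ((t : ℝ) + cayleyVertexDist S g w)
      (1 - (t : ℝ) + cayleyVertexDist S (g * s) w) with h | h <;>
    rcases min_choice ((t : ℝ) + cayleyVertexDist S g v)
      (1 - (t : ℝ) + cayleyVertexDist S (g * s) v) with h' | h' <;> rw [h, h'] <;> linarith

theorem pathDist_le_add (p q : CayleyCell S hS) (w : G) :
    pathDist p q ≤ distVertex p w + distVertex q w := by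
  cases p with
  | vertex g =>
    have := distVertex_le_add q g w
    rw [vertexDist_comm] at this
    have e1 : pathDist (vertex g) q = distVertex q g := rfl
    have e2 : distVertex (vertex g : CayleyCell S hS) w = cayleyVertexDist S g w := rfl
    rw [e1, e2]
    linarith
  | edge g s t =>
    cases q with
    | vertex h =>
      have := distVertex_le_add (edge g s t : CayleyCell S hS) h w
      rw [vertexDist_comm] at this
      simpa only [pathDist, distVertex] using this
    | edge h r u =>
      have key : min ((t : ℝ) + distVertex (edge h r u : CayleyCell S hS) g)
          (1 - (t : ℝ) + distVertex (edge h r u : CayleyCell S hS) (g * s)) ≤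
          distVertex (edge g s t : CayleyCell S hS) w +
            distVertex (edge h r u : CayleyCell S hS) w := by
        have h1 := distVertex_le_add (edge h r u : CayleyCell S hS) g w
        have h2 := distVertex_le_add (edge h r u : CayleyCell S hS) (g * s) w
        rw [vertexDist_comm] at h1 h2
        have h3 : distVertex (edge g s t : CayleyCell S hS) w =
          min ((t : ℝ) + cayleyVertexDist S g w)
            (1 - (t : ℝ) + cayleyVertexDist S (g * s) w) := rfl
        rcases min_choice ((t : ℝ) + cayleyVertexDist S g w)
          (1 - (t : ℝ) + cayleyVertexDist S (g * s) w) with h | h <;> rw [h3, h]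
        · exact (min_le_left _ _).trans (by linarith)
        · exact (min_le_right _ _).trans (by linarith)
      rw [pathDist]
      split_ifs
      · exact (min_le_right _ _).trans key
      · exact key

theorem pathDist_cases (p q : CayleyCell S hS) :
    (∃ w, distVertex p w + distVertex q w ≤ pathDist p q) ∨
      ∃ (g : G) (s : S) (t u : unitInterval),
        p = edge g s t ∧ q = edge g s u ∧ pathDist p q = |(t : ℝ) - u| := by
  cases p with
  | vertex g =>
    refine Or.inl ⟨g, ?_⟩
    simp only [pathDist, distVertex, vertexDist_self, zero_add, le_refl]
  | edge g s t =>
    cases q with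
    | vertex h =>
      refine Or.inl ⟨h, ?_⟩
      simp only [pathDist, distVertex, vertexDist_self, add_zero, le_refl]
    | edge h r u =>
      have b1 : distVertex (edge g s t : CayleyCell S hS) g ≤ t := by
        refine (min_le_left _ _).trans ?_
        rw [vertexDist_self, add_zero]
      have b2 : distVertex (edge g s t : CayleyCell S hS) (g * s) ≤ 1 - t := by
        refine (min_le_right _ _).trans ?_
        rw [vertexDist_self, add_zero]
      have key : ∃ w, distVertex (edge g s t : CayleyCell S hS) w +
          distVertex (edge h r u : CayleyCell S hS) w ≤
          min ((t : ℝ) + distVertex (edge h r u : CayleyCell S hS) g)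
          (1 - (t : ℝ) + distVertex (edge h r u : CayleyCell S hS) (g * s)) := by
        rcases min_choice ((t : ℝ) + distVertex (edge h r u : CayleyCell S hS) g)
          (1 - (t : ℝ) + distVertex (edge h r u : CayleyCell S hS) (g * s)) with e | e <;> rw [e]
        · exact ⟨g, by linarith⟩
        · exact ⟨g * s, by linarith⟩
      rw [pathDist]
      split_ifs with hc
      · obtain ⟨rfl, rfl⟩ := hc
        rcases le_total |(t : ℝ) - (u : ℝ)|
          (min ((t : ℝ) + distVertex (edge g s u : CayleyCell S hS) g)
            (1 - (t : ℝ) + distVertex (edge g s u : CayleyCell S hS) (g * s))) with e | e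
        · exact Or.inr ⟨g, s, t, u, rfl, rfl, min_eq_left e⟩
        · rw [min_eq_right e]
          exact Or.inl key
      · exact Or.inl key

theorem pathDist_same_edge_le (g : G) (s : S) (t u : unitInterval) :
    pathDist (edge g s t : CayleyCell S hS) (edge g s u) ≤ |(t : ℝ) - u| := by
  rw [pathDist, if_pos ⟨rfl, rfl⟩]
  exact min_le_left _ _

theorem distVertex_same_edge_le (g : G) (s : S) (t u : unitInterval) (w : G) :
    distVertex (edge g s t : CayleyCell S hS) w ≤
      |(t : ℝ) - u| + distVertex (edge g s u : CayleyCell S hS) w := by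
  have h1 := le_abs_self ((t : ℝ) - u)
  have h2 := neg_abs_le ((t : ℝ) - u)
  simp only [distVertex]
  rcases min_choice ((u : ℝ) + cayleyVertexDist S g w)
    (1 - (u : ℝ) + cayleyVertexDist S (g * s) w) with h | h <;> rw [h]
  · exact (min_le_left _ _).trans (by linarith)
  · exact (min_le_right _ _).trans (by linarith)

theorem pathDist_self (p : CayleyCell S hS) : pathDist p p = 0 := by
  cases p with
  | vertex g => simp only [pathDist, distVertex, vertexDist_self]
  | edge g s t =>
    refine le_antisymm ((pathDist_same_edge_le g s t t).trans (by simp)) ?_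
    rcases pathDist_cases (edge g s t : CayleyCell S hS) (edge g s t) with ⟨w, h⟩ | ⟨_, _, _, _, _, _, h⟩
    · have := vertexDist_le_add (edge g s t : CayleyCell S hS) w w
      rw [vertexDist_self] at this
      linarith
    · rw [h]; exact abs_nonneg _

theorem pathDist_comm_le (p q : CayleyCell S hS) : pathDist p q ≤ pathDist q p := by
  rcases pathDist_cases q p with ⟨w, h⟩ | ⟨g, s, t, u, rfl, rfl, h⟩
  · have := pathDist_le_add p q w
    linarith
  · rw [h, abs_sub_comm]
    exact pathDist_same_edge_le g s u t

theorem pathDist_triangle (p q r : CayleyCell S hS) :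
    pathDist p r ≤ pathDist p q + pathDist q r := by
  rcases pathDist_cases p q with ⟨w, h⟩ | ⟨g, s, t, u, rfl, rfl, h⟩
  · rcases pathDist_cases q r with ⟨w', h'⟩ | ⟨g', s', t', u', rfl, rfl, h'⟩
    · have h1 := pathDist_le_add p r w
      have h2 := distVertex_le_add r w w'
      have h3 := vertexDist_le_add q w' w
      linarith
    · have h1 := pathDist_le_add p (edge g' s' u') w
      have h2 := distVertex_same_edge_le (hS := hS) g' s' u' t' w
      rw [abs_sub_comm] at h2
      linarith
  · rcases pathDist_cases (edge g s u : CayleyCell S hS) r with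
      ⟨w', h'⟩ | ⟨g', s', t', u', he, rfl, h'⟩
    · have h1 := pathDist_le_add (edge g s t) r w'
      have h2 := distVertex_same_edge_le (hS := hS) g s t u w'
      linarith
    · cases he
      rw [h, h']
      exact (pathDist_same_edge_le g s t u').trans (abs_sub_le _ _ _)

noncomputable instance : PseudoMetricSpace (CayleyCell S hS) where
  dist := pathDist
  dist_self := pathDist_self
  dist_comm p q := le_antisymm (pathDist_comm_le p q) (pathDist_comm_le q p)
  dist_triangle := pathDist_triangle

end CayleyCell

/-- The Cayley graph of `G` with respect to a generating set `S`, as a 1-complex with the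
combinatorial metric: the pieces of `CayleyCell` are glued by identifying points at distance `0`,
that is, the ends of each edge with the vertices they belong to. -/
abbrev CayleyComplex (S : Set G) (hS : Subgroup.closure S = ⊤) : Type _ :=
  SeparationQuotient (CayleyCell S hS)

/-- `X` together with the union of the subgroups in `𝓗`. -/
def relativeGenerators (X : Set G) (𝓗 : Set (Subgroup G)) : Set G :=
  X ∪ ⋃ P ∈ 𝓗, (P : Set G)

/-- `G` is weakly hyperbolic relative to the collection `𝓗` of subgroups: there is a finite set
`X` such that `X` and the members of `𝓗` together generate `G` and the Cayley graph of `G` with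
respect to the union of `X` and the members of `𝓗` is a hyperbolic metric space. -/
def WeaklyHyperbolicRelativeTo (𝓗 : Set (Subgroup G)) : Prop :=
  ∃ X : Set G, X.Finite ∧ ∃ hX : Subgroup.closure (relativeGenerators X 𝓗) = ⊤,
    IsHyperbolicMetricSpace (CayleyComplex (relativeGenerators X 𝓗) hX)

end CayleyComplex

section Amalgam

variable {H K : Type*} [Group H] [Group K] {A : Subgroup H} {B : Subgroup K}

/-- The relators `a * (μ a)⁻¹`, `a ∈ A`, in the free product of `H` and `K`. -/
def amalgamRelators (μ : A ≃* B) : Set (Monoid.Coprod H K) :=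
  Set.range fun a : A => Monoid.Coprod.inl (a : H) * (Monoid.Coprod.inr (μ a : K))⁻¹

/-- The amalgamated free product of `H` and `K` along the isomorphism `μ : A ≃* B`: the quotient
of the free product of `H` and `K` by the relations `a = μ a`, `a ∈ A`. -/
abbrev AmalgamatedProduct (μ : A ≃* B) : Type _ :=
  Monoid.Coprod H K ⧸ Subgroup.normalClosure (amalgamRelators μ)

namespace AmalgamatedProduct

/-- The canonical homomorphism from `H` to the amalgamated free product. -/
def inl (μ : A ≃* B) : H →* AmalgamatedProduct μ :=
  (QuotientGroup.mk' (Subgroup.normalClosure (amalgamRelators μ))).comp Monoid.Coprod.inl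

/-- The canonical homomorphism from `K` to the amalgamated free product. -/
def inr (μ : A ≃* B) : K →* AmalgamatedProduct μ :=
  (QuotientGroup.mk' (Subgroup.normalClosure (amalgamRelators μ))).comp Monoid.Coprod.inr

end AmalgamatedProduct
end Amalgam

/-!
Hyperbolicity of a Cayley complex is first reduced to its vertices. A geodesic space is hyperbolic
if and only if there is a constant `c` such that each point `p` between `x` and `y` lies, up to the
error `c`, between `x` and `z` or between `y` and `z`, for every `z` (`IsSlimDist`). This condition
only mentions the metric, and it passes between a Cayley complex and the word metric of the group
(`CayleyComplex.isHyperbolic_of_isSlimDist`, `CayleyComplex.exists_isSlimDist_of_isHyperbolic`),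
because every point of the complex is close to a vertex.

Let now `G` be the amalgamated product and let `S` be a generating set of `G` that lies in `H ∪ K`
and contains `A`. Then `A` has diameter at most `1` in the word metric, and it separates the Cayley
graph: by the normal form theorem, `G` is the disjoint union of `A`, the alternating products that
start in `H \ A` and those that start in `K \ A`, and no edge joins the last two sets. So a geodesic
between the two sides passes through `A` (`IsInternalAmalgam.exists_wordDist_eq_add`). The same holds
for the translates of `A`. It follows that `H` and `K` with their own word metrics embed
isometrically (`IsInternalAmalgam.wordDist_map`), since an excursion out of `H` leaves and returns
through the same coset of `A`.

For the combination theorem `IsInternalAmalgam.isSlimDist`, translate `p` to `1`. If `A` separates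
`z` from `x` or from `y`, or `x` from `y`, then a geodesic between the separated points passes within
distance `1` of `p`. Otherwise all three points lie beyond cosets of `A` in one factor, say `H`. The
geodesics from them to `1` enter `H` through three gates in `H`, and thinness of the triangle of the
gates implies thinness of the original triangle, because the gates of `x` and `y` lie in different
cosets when `1` is between `x` and `y`.

Both statements are instances. With `S = H ∪ K` the factors have diameter at most `1`. With
`S = X ∪ Y ∪ A`, where `X` and `Y` witness the hypotheses on `H` and `K`, the factors carry the word
metrics of `X ∪ A` and `Y ∪ B`. The normal form theorem is taken from Mathlib's `Monoid.PushoutI`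
through a homomorphism from the amalgamated product to the pushout (`AmalgamatedProduct.toPushout`).
-/

/-! ### Alternating products in a group generated by two subgroups -/

section Alternating

variable {G : Type*} [Group G]

/-- `StartsIn P b g` says that `g` is a nonempty product whose factors lie alternately in
`P b \ P (!b)` and in `P (!b) \ P b`, the first factor being in `P b \ P (!b)`. -/
inductive StartsIn (P : Bool → Subgroup G) : Bool → G → Prop
  | single {b : Bool} {g : G} (hg : g ∈ P b) (hg' : g ∉ P (!b)) : StartsIn P b g
  | cons {b : Bool} {g x : G} (hg : g ∈ P b) (hg' : g ∉ P (!b)) (hx : StartsIn P (!b) x) :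
      StartsIn P b (g * x)

/-- `G` is the internal amalgamated product of `P true` and `P false` over their intersection:
the two subgroups generate `G`, and an alternating product determines the subgroup containing its
first factor and never lies in both subgroups. -/
structure IsInternalAmalgam (P : Bool → Subgroup G) : Prop where
  sup_eq_top : P true ⊔ P false = ⊤
  not_startsIn_not : ∀ {b g}, StartsIn P b g → ¬ StartsIn P (!b) g
  not_mem_inter : ∀ {b g}, StartsIn P b g → ¬ ∀ b', g ∈ P b'

/-- The closed half of `G` on the side of `P b`: the intersection of the two subgroups together
with the alternating products that start in `P b`. In terms of the Bass–Serre tree with base edge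
`e`, these are the elements `g` for which the edge `g • e` is `e` or lies on the same side of `e` as
the vertex stabilised by `P b`. -/
def InHalf (P : Bool → Subgroup G) (b : Bool) (g : G) : Prop :=
  (∀ b', g ∈ P b') ∨ StartsIn P b g

variable {P : Bool → Subgroup G}

theorem mem_all_iff {g : G} (b : Bool) : (∀ b', g ∈ P b') ↔ g ∈ P b ∧ g ∈ P (!b) := by
  cases b <;> simp [Bool.forall_bool, and_comm]

theorem inHalf_of_mem {b : Bool} {g : G} (hg : g ∈ P b) : InHalf P b g := by
  by_cases h : g ∈ P (!b)
  · exact Or.inl ((mem_all_iff b).2 ⟨hg, h⟩)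
  · exact Or.inr (.single hg h)

theorem inHalf_one (b : Bool) : InHalf P b 1 := Or.inl fun _ => one_mem _

theorem startsIn_mul {b : Bool} {g x : G} (hg : g ∈ P b) (hg' : g ∉ P (!b))
    (hx : InHalf P (!b) x) : StartsIn P b (g * x) := by
  rcases hx with hx | hx
  · exact .single (mul_mem hg (hx b)) fun h => hg' ((mul_mem_cancel_right (hx _)).1 h)
  · exact .cons hg hg' hx

theorem StartsIn.exists_eq_mul {b : Bool} {g : G} (h : StartsIn P b g) :
    ∃ p x, p ∈ P b ∧ p ∉ P (!b) ∧ InHalf P (!b) x ∧ g = p * x := by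
  cases h with
  | single hg hg' => exact ⟨g, 1, hg, hg', inHalf_one _, (mul_one g).symm⟩
  | cons hg hg' hx => exact ⟨_, _, hg, hg', Or.inr hx, rfl⟩

/-- Right multiplication by an element of either subgroup does not cross from one open half to the
other. -/
theorem StartsIn.inHalf_mul {b b' : Bool} {g s : G} (h : StartsIn P b g) (hs : s ∈ P b') :
    InHalf P b (g * s) := by
  induction h with
  | @single b g hg hg' =>
    by_cases hsb : s ∈ P b
    · exact inHalf_of_mem (mul_mem hg hsb)
    · have hbb : b' = !b := by
        rcases Bool.eq_or_eq_not b' b with rfl | h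
        · exact absurd hs hsb
        · exact h
      subst hbb
      exact Or.inr (startsIn_mul hg hg' (inHalf_of_mem hs))
  | cons hg hg' _ ih =>
    rw [mul_assoc]
    exact Or.inr (startsIn_mul hg hg' ih)

theorem InHalf.exists_inHalf_mul {b : Bool} {g : G} (h : InHalf P (!b) g) {p : G} (hp : p ∈ P b) :
    InHalf P true (p * g) ∨ InHalf P false (p * g) := by
  by_cases hp' : p ∈ P (!b)
  · rcases h with h | h
    · have := inHalf_of_mem (mul_mem hp (h b))
      cases b <;> simp [this]
    · obtain ⟨q, x, hq, hq', hx, rfl⟩ := h.exists_eq_mul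
      have := startsIn_mul (P := P) (mul_mem hp' hq)
        (fun hm => hq' ((mul_mem_cancel_left (by simpa using hp)).1 hm)) hx
      rw [mul_assoc] at this
      cases b
      · exact Or.inl (Or.inr this)
      · exact Or.inr (Or.inr this)
  · have := startsIn_mul hp hp' h
    cases b
    · exact Or.inr (Or.inr this)
    · exact Or.inl (Or.inr this)

theorem exists_inHalf_mul {b : Bool} {g p : G} (h : ∃ b, InHalf P b g) (hp : p ∈ P b) :
    ∃ b, InHalf P b (p * g) := by
  obtain ⟨b', h⟩ := h
  rcases Bool.eq_or_eq_not b' b with rfl | rfl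
  · rcases h with h | h
    · exact ⟨_, inHalf_of_mem (mul_mem hp (h b'))⟩
    · obtain ⟨q, x, hq, -, hx, rfl⟩ := h.exists_eq_mul
      have := hx.exists_inHalf_mul (mul_mem hp hq)
      rw [← mul_assoc]
      exact this.elim (fun h => ⟨_, h⟩) fun h => ⟨_, h⟩
  · exact (h.exists_inHalf_mul hp).elim (fun h => ⟨_, h⟩) fun h => ⟨_, h⟩

namespace IsInternalAmalgam

variable (hP : IsInternalAmalgam P)
include hP

theorem exists_inHalf (g : G) : ∃ b, InHalf P b g := by
  have hg : g ∈ Subgroup.closure ((P true : Set G) ∪ P false) := by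
    rw [Subgroup.closure_union, Subgroup.closure_eq, Subgroup.closure_eq, hP.sup_eq_top]
    trivial
  induction hg using Subgroup.closure_induction_left with
  | one => exact ⟨true, inHalf_one _⟩
  | mul_left x hx y _ ih => exact hx.elim (exists_inHalf_mul ih) (exists_inHalf_mul ih)
  | inv_mul_cancel x hx y _ ih =>
    exact hx.elim (fun h => exists_inHalf_mul ih (inv_mem h))
      fun h => exists_inHalf_mul ih (inv_mem h)

theorem startsIn_not_of_not_inHalf {b : Bool} {g : G} (h : ¬ InHalf P b g) : StartsIn P (!b) g := by
  obtain ⟨b', h'⟩ := hP.exists_inHalf g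
  rcases Bool.eq_or_eq_not b' b with rfl | rfl
  · exact absurd h' h
  · exact h'.resolve_left fun hc => h (Or.inl hc)

theorem mem_inter_of_inHalf {b : Bool} {g : G} (h : InHalf P b g) (h' : InHalf P (!b) g) :
    ∀ b', g ∈ P b' := by
  rcases h with h | h
  · exact h
  · exact h'.resolve_right (hP.not_startsIn_not h)

end IsInternalAmalgam

end Alternating

/-! ### Word metrics on amalgamated products -/

section WordMetric

variable {G : Type*} [Group G]

/-- The word metric on `G` with respect to `S`, as a natural number. -/
noncomputable def wordDist (S : Set G) (u v : G) : ℕ := (SimpleGraph.mulCayley S).dist u v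

variable {S : Set G}

theorem wordDist_comm (u v : G) : wordDist S u v = wordDist S v u := SimpleGraph.dist_comm

theorem wordDist_self (u : G) : wordDist S u u = 0 := SimpleGraph.dist_self

theorem wordDist_triangle (hS : Subgroup.closure S = ⊤) (u v w : G) :
    wordDist S u w ≤ wordDist S u v + wordDist S v w :=
  (mulCayley_connected_of_closure_eq_top hS).dist_triangle

theorem eq_of_wordDist_eq_zero (hS : Subgroup.closure S = ⊤) {u v : G} (h : wordDist S u v = 0) :
    u = v :=
  (mulCayley_connected_of_closure_eq_top hS).dist_eq_zero_iff.1 h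

theorem wordDist_mul_le_one {s : G} (hs : s ∈ S) (u : G) : wordDist S u (u * s) ≤ 1 := by
  have : ((wordDist S u (u * s) : ℕ) : ℝ) ≤ 1 :=
    CayleyCell.vertexDist_mul_le_one u (⟨s, hs⟩ : S)
  exact_mod_cast this

/-- A homomorphism that maps generators to generators does not increase word distances. -/
theorem wordDist_map_le {H : Type*} [Group H] {T : Set H} (hT : Subgroup.closure T = ⊤)
    (hS : Subgroup.closure S = ⊤) (f : H →* G) (hf : ∀ t ∈ T, f t ∈ S) (u v : H) :
    wordDist S (f u) (f v) ≤ wordDist T u v := by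
  obtain ⟨p, hp⟩ := (mulCayley_connected_of_closure_eq_top hT).exists_walk_length_eq_dist u v
  rw [wordDist, wordDist, ← hp]
  clear hp
  induction p with
  | nil => simp
  | @cons a b c hab p ih =>
    have hs : wordDist S (f a) (f b) ≤ 1 := by
      obtain ⟨-, t, ht, rfl | rfl⟩ := (SimpleGraph.mulCayley_adj' T a b).1 hab
      · rw [map_mul]; exact wordDist_mul_le_one (hf t ht) _
      · rw [map_mul, wordDist_comm]; exact wordDist_mul_le_one (hf t ht) _
    have := wordDist_triangle hS (f a) (f b) (f c)
    simp only [wordDist, SimpleGraph.Walk.length_cons] at *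
    omega

theorem wordDist_mul_left_le (hS : Subgroup.closure S = ⊤) (g u v : G) :
    wordDist S (g * u) (g * v) ≤ wordDist S u v := by
  obtain ⟨p, hp⟩ := (mulCayley_connected_of_closure_eq_top hS).exists_walk_length_eq_dist u v
  rw [wordDist, wordDist, ← hp]
  clear hp
  induction p with
  | nil => simp
  | @cons a b c hab p ih =>
    have hs : wordDist S (g * a) (g * b) = 1 :=
      SimpleGraph.dist_eq_one_iff_adj.2 (SimpleGraph.mulCayley_adj_mul_iff_right.2 hab)
    have := wordDist_triangle hS (g * a) (g * b) (g * c)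
    simp only [wordDist, SimpleGraph.Walk.length_cons] at *
    omega

theorem wordDist_mul_left (hS : Subgroup.closure S = ⊤) (g u v : G) :
    wordDist S (g * u) (g * v) = wordDist S u v := by
  refine le_antisymm (wordDist_mul_left_le hS g u v) ?_
  simpa using wordDist_mul_left_le hS g⁻¹ (g * u) (g * v)

theorem exists_wordDist_succ (hS : Subgroup.closure S = ⊤) {u v : G} (h : u ≠ v) :
    ∃ w, (SimpleGraph.mulCayley S).Adj u w ∧ wordDist S u v = wordDist S w v + 1 := by
  obtain ⟨p, hp⟩ := (mulCayley_connected_of_closure_eq_top hS).exists_walk_length_eq_dist u v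
  cases p with
  | nil => exact absurd rfl h
  | @cons _ w _ hab p =>
    refine ⟨w, hab, le_antisymm ?_ ?_⟩
    · have h1 : wordDist S u w = 1 := SimpleGraph.dist_eq_one_iff_adj.2 hab
      have := wordDist_triangle hS u w v
      omega
    · have := SimpleGraph.dist_le p
      simp only [wordDist, SimpleGraph.Walk.length_cons] at *
      omega

theorem exists_wordDist_eq (hS : Subgroup.closure S = ⊤) {u v : G} {n : ℕ}
    (hn : n ≤ wordDist S u v) :
    ∃ w, wordDist S u w = n ∧ wordDist S w v = wordDist S u v - n := by
  induction n generalizing u with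
  | zero => exact ⟨u, wordDist_self u, rfl⟩
  | succ n ih =>
    have huv : u ≠ v := by rintro rfl; simp [wordDist_self] at hn
    obtain ⟨w, hw, h⟩ := exists_wordDist_succ hS huv
    have huw : wordDist S u w = 1 := SimpleGraph.dist_eq_one_iff_adj.2 hw
    obtain ⟨x, h1, h2⟩ := ih (u := w) (by omega)
    have t1 := wordDist_triangle hS u w x
    have t2 := wordDist_triangle hS u x v
    exact ⟨x, by omega, by omega⟩

variable {P : Bool → Subgroup G}

/-- A generating set adapted to the two subgroups: `S` generates `G`, lies in the union of
`P true` and `P false`, and contains their intersection, the edge group. -/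
structure IsAdaptedGeneratingSet (P : Bool → Subgroup G) (S : Set G) : Prop where
  closure_eq_top : Subgroup.closure S = ⊤
  exists_mem : ∀ s ∈ S, ∃ b, s ∈ P b
  mem_of_mem_inter : ∀ g, (∀ b, g ∈ P b) → g ∈ S

namespace IsInternalAmalgam

variable (hP : IsInternalAmalgam P) (hS : IsAdaptedGeneratingSet P S)
include hP hS

/-- The edge group separates its two sides: a geodesic between opposite halves of `G` passes
through it. -/
theorem exists_wordDist_eq_add {b : Bool} {x y : G} (hx : InHalf P b x) (hy : InHalf P (!b) y) :
    ∃ c, (∀ b', c ∈ P b') ∧ wordDist S x y = wordDist S x c + wordDist S c y := by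
  suffices key : ∀ (x y : G) (p : (SimpleGraph.mulCayley S).Walk x y), InHalf P b x →
      InHalf P (!b) y →
      ∃ c, (∀ b', c ∈ P b') ∧ wordDist S x c + wordDist S c y ≤ p.length by
    obtain ⟨p, hp⟩ :=
      (mulCayley_connected_of_closure_eq_top hS.closure_eq_top).exists_walk_length_eq_dist x y
    obtain ⟨c, hc, h⟩ := key x y p hx hy
    refine ⟨c, hc, le_antisymm (wordDist_triangle hS.closure_eq_top _ _ _) ?_⟩
    rw [wordDist, wordDist, wordDist, ← hp]
    exact h
  intro x y p
  induction p with
  | nil =>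
    intro hx hy
    exact ⟨_, hP.mem_inter_of_inHalf hx hy, by simp [wordDist_self]⟩
  | @cons x x' y hab p ih =>
    intro hx hy
    rcases hx with hx | hx
    · exact ⟨x, hx, by simpa [wordDist_self] using! SimpleGraph.dist_le (.cons hab p)⟩
    · have hx' : InHalf P b x' := by
        obtain ⟨-, s, hs, rfl | rfl⟩ := (SimpleGraph.mulCayley_adj' S x x').1 hab
        · exact hx.inHalf_mul (hS.exists_mem s hs).choose_spec
        · have := hx.inHalf_mul (inv_mem (hS.exists_mem s hs).choose_spec)
          rwa [mul_inv_cancel_right] at this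
      obtain ⟨c, hc, h⟩ := ih hx' hy
      have h1 : wordDist S x x' = 1 := SimpleGraph.dist_eq_one_iff_adj.2 hab
      have := wordDist_triangle hS.closure_eq_top x x' c
      refine ⟨c, hc, ?_⟩
      rw [SimpleGraph.Walk.length_cons]
      omega

/-- The translate by `g` of the edge group separates the translates of the two halves. -/
theorem exists_wordDist_eq_add_translate {b : Bool} {g x y : G} (hx : InHalf P b (g⁻¹ * x))
    (hy : InHalf P (!b) (g⁻¹ * y)) :
    ∃ c, (∀ b', c ∈ P b') ∧ wordDist S x y = wordDist S x (g * c) + wordDist S (g * c) y := by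
  obtain ⟨c, hc, h⟩ := hP.exists_wordDist_eq_add hS hx hy
  refine ⟨c, hc, ?_⟩
  have h1 := wordDist_mul_left hS.closure_eq_top g⁻¹
  rw [h1, ← inv_mul_cancel_left g c, h1, h1] at h
  exact h

omit hP in
theorem _root_.IsAdaptedGeneratingSet.wordDist_mul_le_one {c : G} (hc : ∀ b, c ∈ P b) (g : G) :
    wordDist S g (g * c) ≤ 1 :=
  _root_.wordDist_mul_le_one (hS.mem_of_mem_inter c hc) g

theorem wordDist_add_le_translate {b : Bool} {g x y : G} (hx : InHalf P b (g⁻¹ * x))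
    (hy : InHalf P (!b) (g⁻¹ * y)) :
    wordDist S x g + wordDist S g y ≤ wordDist S x y + 2 := by
  obtain ⟨c, hc, h⟩ := hP.exists_wordDist_eq_add_translate hS hx hy
  have h1 := hS.wordDist_mul_le_one hc g
  have h2 := wordDist_triangle hS.closure_eq_top x (g * c) g
  have h3 := wordDist_triangle hS.closure_eq_top g (g * c) y
  have h4 := wordDist_comm (S := S) (g * c) g
  omega

/-- A vertex group is isometrically embedded in `G`: a geodesic that leaves it does so through a
coset of the edge group and returns through the same coset, whose diameter is at most `1`. -/
theorem wordDist_map {H : Type*} [Group H] {T : Set H} (hT : Subgroup.closure T = ⊤)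
    {f : H →* G} (hf : Function.Injective f) {b : Bool} (hrange : f.range = P b)
    (hTS : f '' T = S ∩ P b) (u v : H) : wordDist S (f u) (f v) = wordDist T u v := by
  have hfT : ∀ t ∈ T, f t ∈ S := fun t ht => (hTS.subset (Set.mem_image_of_mem f ht)).1
  refine le_antisymm (wordDist_map_le hT hS.closure_eq_top f hfT u v) ?_
  induction hn : wordDist S (f u) (f v) using Nat.strong_induction_on generalizing u v with
  | _ n ih =>
  subst hn
  by_cases huv : f u = f v
  · rw [hf huv, wordDist_self]; exact Nat.zero_le _
  obtain ⟨w, hw, h⟩ := exists_wordDist_succ hS.closure_eq_top huv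
  have hfP : ∀ u, f u ∈ P b := fun u => hrange ▸ ⟨u, rfl⟩
  -- write the first step as right multiplication by `s`, where `s` or `s⁻¹` is a generator
  obtain ⟨s, hs, rfl⟩ : ∃ s, (s ∈ S ∨ s⁻¹ ∈ S) ∧ w = f u * s := by
    obtain ⟨-, s, hs, h | h⟩ := (SimpleGraph.mulCayley_adj' S _ w).1 hw
    · exact ⟨s, Or.inl hs, h.symm⟩
    · exact ⟨s⁻¹, Or.inr (by simpa using hs), by rw [h, mul_inv_cancel_right]⟩
  have key : ∀ t, f t = s → wordDist T u v ≤ wordDist S (f u) (f v) := by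
    rintro t rfl
    have h1 : wordDist T u (u * t) ≤ 1 := by
      rcases hs with hs | hs
      · obtain ⟨t', ht', he⟩ := hTS.symm.subset ⟨hs, hfP t⟩
        rw [← hf he]
        exact wordDist_mul_le_one ht' u
      · obtain ⟨t', ht', he⟩ := hTS.symm.subset ⟨hs, inv_mem (hfP t)⟩
        rw [← map_inv] at he
        have := wordDist_mul_le_one ht' (u * t)
        rwa [hf he, mul_inv_cancel_right, wordDist_comm] at this
    have h2 := ih (wordDist S (f (u * t)) (f v)) (by rw [map_mul]; omega) (u * t) v rfl
    have h3 := wordDist_triangle hT u (u * t) v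
    rw [map_mul] at h2
    omega
  by_cases hsb : s ∈ P b
  · obtain ⟨t, ht⟩ : s ∈ f.range := hrange ▸ hsb
    exact key t ht
  have hs' : s ∈ P (!b) := by
    obtain ⟨b', hb'⟩ : ∃ b', s ∈ P b' := by
      rcases hs with hs | hs
      · exact hS.exists_mem s hs
      · exact (hS.exists_mem _ hs).imp fun _ h => (inv_mem_iff (G := G)).1 h
    rcases Bool.eq_or_eq_not b' b with rfl | rfl
    · exact absurd hb' hsb
    · exact hb'
  obtain ⟨c, hc, h'⟩ := hP.exists_wordDist_eq_add_translate hS (b := b) (g := f u) (x := f v)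
    (y := f u * s) (by rw [← map_inv, ← map_mul]; exact inHalf_of_mem (hfP _))
    (by rw [inv_mul_cancel_left]; exact inHalf_of_mem hs')
  obtain ⟨a, rfl⟩ : c ∈ f.range := hrange ▸ hc b
  have hne : wordDist S (f u * f a) (f u * s) ≠ 0 := fun h0 => hsb <| by
    rw [← mul_left_cancel (eq_of_wordDist_eq_zero hS.closure_eq_top h0)]
    exact hc b
  have h1 : wordDist T u (u * a) ≤ 1 := by
    obtain ⟨t', ht', he⟩ := hTS.symm.subset ⟨hS.mem_of_mem_inter _ hc, hc b⟩
    rw [← hf he]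
    exact wordDist_mul_le_one ht' u
  have e1 := wordDist_comm (S := S) (f u * s) (f v)
  have e2 := wordDist_comm (S := S) (f u * f a) (f v)
  have h2 := ih (wordDist S (f (u * a)) (f v)) (by rw [map_mul]; omega) (u * a) v rfl
  have h3 := wordDist_triangle hT u (u * a) v
  rw [map_mul] at h2
  omega

end IsInternalAmalgam

end WordMetric

/-! ### Thin triangles in an amalgamated product -/

/-- A combinatorial form of thin triangles for a distance function `d`: if `p` lies between `x` and
`y`, then, up to an error `c`, it lies between `x` and `z` or between `y` and `z`. -/
def IsSlimDist {X R : Type*} [Add R] [LE R] (d : X → X → R) (c : R) : Prop :=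
  ∀ x y z p, d x p + d p y = d x y → d x p + d p z ≤ d x z + c ∨ d y p + d p z ≤ d y z + c

section

variable {G : Type*} [Group G] {S : Set G} {P : Bool → Subgroup G}

theorem InHalf.mul_of_mem_inter {b : Bool} {c g : G} (h : InHalf P b g) (hc : ∀ b, c ∈ P b) :
    InHalf P b (c * g) := by
  rcases h with h | h
  · exact Or.inl fun b' => mul_mem (hc b') (h b')
  · obtain ⟨q, x, hq, hq', hx, rfl⟩ := h.exists_eq_mul
    rw [← mul_assoc]
    exact Or.inr (startsIn_mul (mul_mem (hc b) hq)
      (fun hm => hq' ((mul_mem_cancel_left (hc _)).1 hm)) hx)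

namespace IsInternalAmalgam

variable (hP : IsInternalAmalgam P) (hS : IsAdaptedGeneratingSet P S)
include hP hS

/-- The point where a geodesic from `x` to `1` enters the vertex group `P b`, for `x` beyond a coset
`p * (P true ⊓ P false)` of the edge group in `P b`. -/
theorem exists_gate {b : Bool} {x : G} (hx : StartsIn P b x) :
    ∃ p, p ∈ P b ∧ p ∉ P (!b) ∧ InHalf P (!b) (p⁻¹ * x) ∧
      wordDist S x 1 = wordDist S x p + wordDist S p 1 := by
  obtain ⟨q, w, hq, hq', hw, rfl⟩ := hx.exists_eq_mul
  obtain ⟨c, hc, h⟩ := hP.exists_wordDist_eq_add_translate hS (b := !b) (g := q) (x := q * w)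
    (y := 1) (by rwa [inv_mul_cancel_left]) (by
      rw [Bool.not_not, mul_one]; exact inHalf_of_mem (inv_mem hq))
  refine ⟨q * c, mul_mem hq (hc b), fun hm => hq' ((mul_mem_cancel_right (hc _)).1 hm), ?_, h⟩
  rw [mul_inv_rev, mul_assoc, inv_mul_cancel_left]
  exact hw.mul_of_mem_inter fun b => inv_mem (hc b)

/-- If `x` and `y` lie beyond different cosets `p (P true ⊓ P false)` and `q (P true ⊓ P false)`,
a path from `x` to `y` passes near `p` and then near `q`. -/
theorem wordDist_add_add_le {b : Bool} {p q x y : G} (hp : p ∈ P b) (hq : q ∈ P b)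
    (hpq : p⁻¹ * q ∉ P (!b)) (hx : InHalf P (!b) (p⁻¹ * x)) (hy : InHalf P (!b) (q⁻¹ * y)) :
    wordDist S x p + wordDist S p q + wordDist S q y ≤ wordDist S x y + 4 := by
  have hy' : InHalf P b (p⁻¹ * y) := by
    have := startsIn_mul (mul_mem (inv_mem hp) hq) hpq hy
    rw [mul_assoc, mul_inv_cancel_left] at this
    exact Or.inr this
  have h1 := hP.wordDist_add_le_translate hS hy' hx
  have h2 := hP.wordDist_add_le_translate hS (inHalf_of_mem (mul_mem (inv_mem hq) hp)) hy
  have e1 := wordDist_comm (S := S) y p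
  have e2 := wordDist_comm (S := S) p x
  have e3 := wordDist_comm (S := S) y x
  omega

omit hP in
theorem wordDist_le_one_of_inv_mul_mem {b : Bool} {p q : G} (hp : p ∈ P b) (hq : q ∈ P b)
    (hpq : p⁻¹ * q ∈ P (!b)) : wordDist S p q ≤ 1 := by
  have := hS.wordDist_mul_le_one ((mem_all_iff b).2 ⟨mul_mem (inv_mem hp) hq, hpq⟩) p
  rwa [mul_inv_cancel_left] at this

/-- Thinness of a triangle with three vertices beyond cosets of the edge group in
the vertex group `P b`, where the geodesic from `x` to `y` passes through `1 ∈ P b`. The gates of the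
three points span a triangle in `P b`, to which the hypothesis on `P b` applies. -/
theorem slim_of_startsIn {b : Bool} {c : ℕ}
    (h : ∀ x ∈ P b, ∀ y ∈ P b, ∀ z ∈ P b, wordDist S x 1 + wordDist S 1 y = wordDist S x y →
      wordDist S x 1 + wordDist S 1 z ≤ wordDist S x z + c ∨
        wordDist S y 1 + wordDist S 1 z ≤ wordDist S y z + c)
    {x y z : G} (hx : StartsIn P b x) (hy : StartsIn P b y) (hz : StartsIn P b z)
    (hxy : wordDist S x 1 + wordDist S 1 y = wordDist S x y) :
    wordDist S x 1 + wordDist S 1 z ≤ wordDist S x z + (2 * c + 6) ∨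
      wordDist S y 1 + wordDist S 1 z ≤ wordDist S y z + (2 * c + 6) := by
  have tri := wordDist_triangle hS.closure_eq_top
  have comm := wordDist_comm (S := S)
  obtain ⟨p, hp, hp', hpx, ex⟩ := hP.exists_gate hS hx
  obtain ⟨q, hq, hq', hqy, ey⟩ := hP.exists_gate hS hy
  obtain ⟨r, hr, hr', hrz, ez⟩ := hP.exists_gate hS hz
  have pos : ∀ g, g ∉ P (!b) → wordDist S g 1 ≠ 0 := fun g hg h0 => hg <| by
    rw [eq_of_wordDist_eq_zero hS.closure_eq_top h0]; exact one_mem _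
  have hp0 := pos p hp'
  have hq0 := pos q hq'
  have cy := comm 1 y
  have cz := comm 1 z
  have cqy := comm q y
  have crz := comm r z
  have cq1 := comm 1 q
  have cr1 := comm 1 r
  -- the gates `p` and `q` lie in different cosets, or the geodesic could be shortened at `1`
  have hpq : p⁻¹ * q ∉ P (!b) := fun hpq => by
    have h1 := wordDist_le_one_of_inv_mul_mem hS hp hq hpq
    have h2 := tri x p y
    have h3 := tri p q y
    omega
  have hbetween : wordDist S p 1 + wordDist S 1 q = wordDist S p q := by
    refine le_antisymm ?_ (tri p 1 q)
    have h2 := tri x p y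
    have h3 := tri p q y
    omega
  have far : ∀ {p x}, p ∈ P b → InHalf P (!b) (p⁻¹ * x) → p⁻¹ * r ∉ P (!b) →
      wordDist S x p + wordDist S p r + wordDist S r z ≤ wordDist S x z + 4 :=
    fun hp hpx hpr => hP.wordDist_add_add_le hS hp hr hpr hpx hrz
  have near : ∀ {p}, p ∈ P b → p⁻¹ * r ∈ P (!b) → wordDist S p r ≤ 1 :=
    fun hp hpr => wordDist_le_one_of_inv_mul_mem hS hp hr hpr
  -- the gate `r` cannot share its coset with both `p` and `q`
  have hpqr : p⁻¹ * r ∈ P (!b) → q⁻¹ * r ∉ P (!b) := fun h1 h2 => hpq <| by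
    have := mul_mem h1 (inv_mem h2)
    rwa [mul_inv_rev, inv_inv, mul_assoc, mul_inv_cancel_left] at this
  rcases h p hp q hq r hr hbetween with h1 | h1
  · by_cases hpr : p⁻¹ * r ∈ P (!b)
    · have h2 := near hp hpr
      have h3 := far hq hqy (hpqr hpr)
      have h4 := tri q r 1
      right; omega
    · have h3 := far hp hpx hpr
      left; omega
  · by_cases hqr : q⁻¹ * r ∈ P (!b)
    · have h2 := near hq hqr
      have h3 := far hp hpx fun h => hpqr h hqr
      have h4 := tri p r 1
      left; omega
    · have h3 := far hq hqy hqr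
      right; omega

/-- Combination theorem: if the vertex groups have thin triangles in the word metric of `G`, then so
does `G`. -/
theorem isSlimDist {c : ℕ}
    (h : ∀ b, ∀ x ∈ P b, ∀ y ∈ P b, ∀ z ∈ P b,
      wordDist S x 1 + wordDist S 1 y = wordDist S x y →
      wordDist S x 1 + wordDist S 1 z ≤ wordDist S x z + c ∨
        wordDist S y 1 + wordDist S 1 z ≤ wordDist S y z + c) :
    IsSlimDist (wordDist S) (2 * c + 6) := by
  intro x y z p hxy
  have inv := wordDist_mul_left hS.closure_eq_top p⁻¹
  rw [← inv x p, ← inv p y, ← inv x y] at hxy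
  rw [← inv x p, ← inv p z, ← inv x z, ← inv y p, ← inv y z]
  rw [inv_mul_cancel] at *
  generalize p⁻¹ * x = x at *
  generalize p⁻¹ * y = y at *
  generalize p⁻¹ * z = z at *
  -- the edge group separates two of the points, or all three start in the same vertex group
  have opposite : ∀ {b x z}, InHalf P b x → InHalf P (!b) z →
      wordDist S x 1 + wordDist S 1 z ≤ wordDist S x z + (2 * c + 6) := fun {b x z} hx hz => by
    have := hP.wordDist_add_le_translate hS (g := 1) (x := x) (y := z) (b := b) (by simpa)
      (by simpa)
    omega
  obtain ⟨b, hx⟩ := hP.exists_inHalf x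
  by_cases hz : InHalf P (!b) z
  · exact Or.inl (opposite hx hz)
  replace hz := hP.startsIn_not_of_not_inHalf hz
  by_cases hy : InHalf P (!b) y
  · exact Or.inr (opposite hy (Or.inr hz))
  replace hy := hP.startsIn_not_of_not_inHalf hy
  by_cases hx' : InHalf P (!b) x
  · exact Or.inl (opposite hx' (Or.inr hz))
  replace hx := hP.startsIn_not_of_not_inHalf hx'
  rw [Bool.not_not] at hx hy hz
  exact hP.slim_of_startsIn hS (h b) hx hy hz hxy

end IsInternalAmalgam

end

/-! ### Hyperbolicity of geodesic spaces -/

section Geodesic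

variable {M : Type*} [MetricSpace M]

/-- A path of speed at most `1` whose length is the distance of its ends is a geodesic. -/
theorem isGeodesicSegment_of_dist_le {x y : M} {ℓ : ℝ} {γ : ℝ → M} (hℓ : 0 ≤ ℓ) (h0 : γ 0 = x)
    (h1 : γ ℓ = y) (hγ : ∀ s t, 0 ≤ s → s ≤ t → t ≤ ℓ → dist (γ s) (γ t) ≤ t - s)
    (hd : ℓ ≤ dist x y) : IsGeodesicSegment (γ '' Set.Icc 0 ℓ) x y := by
  have key : ∀ s t, 0 ≤ s → s ≤ t → t ≤ ℓ → dist (γ s) (γ t) = t - s := by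
    intro s t hs hst ht
    refine le_antisymm (hγ s t hs hst ht) ?_
    have a1 := hγ 0 s le_rfl hs (hst.trans ht)
    have a2 := hγ t ℓ (hs.trans hst) ht le_rfl
    have a3 := dist_triangle4 (γ 0) (γ s) (γ t) (γ ℓ)
    rw [← h0, ← h1] at hd
    linarith
  refine ⟨ℓ, γ, hℓ, h0, h1, fun s hs t ht => ?_, rfl⟩
  rcases le_total s t with hst | hst
  · rw [key s t hs.1 hst ht.2, abs_sub_comm, abs_of_nonneg (by linarith)]
  · rw [dist_comm, key t s ht.1 hst hs.2, abs_of_nonneg (by linarith)]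

theorem isGeodesicSegment_singleton (x : M) : IsGeodesicSegment {x} x x :=
  ⟨0, fun _ => x, le_rfl, rfl, rfl, by simp, by simp⟩

namespace IsGeodesicSegment

variable {P Q : Set M} {x y z : M}

theorem exists_dist_eq (h : IsGeodesicSegment P x y) {t : ℝ} (h0 : 0 ≤ t) (h1 : t ≤ dist x y) :
    ∃ q ∈ P, dist x q = t ∧ dist q y = dist x y - t := by
  obtain ⟨ℓ, γ, hℓ, rfl, rfl, hγ, rfl⟩ := h
  have hl : dist (γ 0) (γ ℓ) = ℓ := by
    rw [hγ 0 ⟨le_rfl, hℓ⟩ ℓ ⟨hℓ, le_rfl⟩, zero_sub, abs_neg, abs_of_nonneg hℓ]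
  rw [hl] at h1 ⊢
  refine ⟨γ t, ⟨t, ⟨h0, h1⟩, rfl⟩, ?_, ?_⟩
  · rw [hγ 0 ⟨le_rfl, hℓ⟩ t ⟨h0, h1⟩, zero_sub, abs_neg, abs_of_nonneg h0]
  · rw [hγ t ⟨h0, h1⟩ ℓ ⟨hℓ, le_rfl⟩, abs_sub_comm, abs_of_nonneg (by linarith)]

theorem dist_add_dist (h : IsGeodesicSegment P x y) {p : M} (hp : p ∈ P) :
    dist x p + dist p y = dist x y := by
  obtain ⟨ℓ, γ, hℓ, rfl, rfl, hγ, rfl⟩ := h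
  obtain ⟨t, ht, rfl⟩ := hp
  rw [hγ 0 ⟨le_rfl, hℓ⟩ t ht, hγ t ht ℓ ⟨hℓ, le_rfl⟩, hγ 0 ⟨le_rfl, hℓ⟩ ℓ ⟨hℓ, le_rfl⟩, zero_sub,
    zero_sub, abs_neg, abs_neg, abs_sub_comm, abs_of_nonneg ht.1, abs_of_nonneg hℓ,
    abs_of_nonneg (sub_nonneg.2 ht.2)]
  ring

theorem symm (h : IsGeodesicSegment P x y) : IsGeodesicSegment P y x := by
  obtain ⟨ℓ, γ, hℓ, rfl, rfl, hγ, rfl⟩ := h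
  refine ⟨ℓ, fun t => γ (ℓ - t), hℓ, by simp, by simp, fun s hs t ht => ?_, ?_⟩
  · rw [hγ _ ⟨by linarith [hs.2], by linarith [hs.1]⟩ _ ⟨by linarith [ht.2], by linarith [ht.1]⟩,
      abs_sub_comm s t]
    congr 1; ring
  · rw [← Function.comp_def γ, Set.image_comp, Set.image_const_sub_Icc]
    simp

/-- Geodesics `x → y` and `y → z` concatenate to a geodesic if `y` lies between `x` and `z`. -/
theorem union (hP : IsGeodesicSegment P x y) (hQ : IsGeodesicSegment Q y z)
    (h : dist x y + dist y z ≤ dist x z) : ∃ R, IsGeodesicSegment R x z ∧ y ∈ R := by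
  obtain ⟨a, γ, ha, rfl, hγa, hγ, rfl⟩ := hP
  obtain ⟨b, η, hb, hη0, rfl, hη, rfl⟩ := hQ
  have hla : dist (γ 0) y = a := by
    rw [← hγa, hγ 0 ⟨le_rfl, ha⟩ a ⟨ha, le_rfl⟩, zero_sub, abs_neg, abs_of_nonneg ha]
  have hlb : dist y (η b) = b := by
    rw [← hη0, hη 0 ⟨le_rfl, hb⟩ b ⟨hb, le_rfl⟩, zero_sub, abs_neg, abs_of_nonneg hb]
  let ζ : ℝ → M := fun t => if t ≤ a then γ t else η (t - a)
  have ζ1 : ∀ t, t ≤ a → ζ t = γ t := fun t ht => if_pos ht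
  have ζ2 : ∀ t, a ≤ t → ζ t = η (t - a) := fun t ht => by
    rcases ht.eq_or_lt with rfl | ht
    · rw [ζ1 _ le_rfl, sub_self, hγa, hη0]
    · exact if_neg ht.not_ge
  have d1 : ∀ s t, 0 ≤ s → s ≤ t → t ≤ a → dist (ζ s) (ζ t) ≤ t - s := fun s t hs hst ht => by
    rw [ζ1 s (hst.trans ht), ζ1 t ht, hγ s ⟨hs, hst.trans ht⟩ t ⟨hs.trans hst, ht⟩, abs_sub_comm,
      abs_of_nonneg (by linarith)]
  have d2 : ∀ s t, a ≤ s → s ≤ t → t ≤ a + b → dist (ζ s) (ζ t) ≤ t - s := fun s t hs hst ht => by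
    rw [ζ2 s hs, ζ2 t (hs.trans hst), hη _ ⟨by linarith, by linarith⟩ _ ⟨by linarith, by linarith⟩,
      abs_sub_comm, abs_of_nonneg (by linarith)]
    linarith
  refine ⟨_, isGeodesicSegment_of_dist_le (γ := ζ) (ℓ := a + b) (by linarith) (ζ1 0 ha)
    (by rw [ζ2 _ (by linarith), add_sub_cancel_left]) (fun s t hs hst ht => ?_) (by linarith),
    a, ⟨ha, by linarith⟩, (ζ1 a le_rfl).trans hγa⟩
  rcases le_total t a with hta | hta
  · exact d1 s t hs hst hta
  rcases le_total s a with hsa | hsa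
  · linarith [dist_triangle (ζ s) (ζ a) (ζ t), d1 s a hs hsa le_rfl, d2 a t le_rfl hta ht]
  · exact d2 s t hsa hst ht

end IsGeodesicSegment

/-- If `p` lies between `x` and `y` up to an error `e`, and `q` is the point of a geodesic from `x`
to `y` at the distance of `p` from `x`, then `q` is close to `p`, provided that the triangle
`x`, `y`, `p` is thin at `q`. -/
theorem dist_le_of_slim {M : Type*} [PseudoMetricSpace M] {x y p q : M} {c e : ℝ} (hc : 0 ≤ c)
    (he : 0 ≤ e)
    (hp : dist x p + dist p y ≤ dist x y + e) (hq : dist x q + dist q y = dist x y)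
    (hxq : dist x q = min (dist x p) (dist x y))
    (h : dist x q + dist q p ≤ dist x p + c ∨ dist y q + dist q p ≤ dist y p + c) :
    dist p q ≤ c + e := by
  have c1 := dist_comm p q
  rcases le_total (dist x p) (dist x y) with hle | hle
  · rw [min_eq_left hle] at hxq
    have c2 := dist_comm y q
    have c3 := dist_comm y p
    rcases h with h | h <;> linarith
  · rw [min_eq_right hle] at hxq
    have := dist_triangle p y q
    have c2 := dist_comm y q
    linarith

theorem isHyperbolicMetricSpace_of_isSlimDist (hM : IsGeodesicMetricSpace M) {c : ℝ} (hc : 0 ≤ c)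
    (h : IsSlimDist (dist : M → M → ℝ) c) : IsHyperbolicMetricSpace M := by
  refine ⟨hM, c + c, by linarith, fun x y z P Q R hP hQ hR p hp => ?_⟩
  have near : ∀ {x z : M} {R : Set M}, IsGeodesicSegment R x z →
      dist x p + dist p z ≤ dist x z + c → ∃ q ∈ R, dist p q ≤ c + c := by
    intro x z R hR hpx
    obtain ⟨q, hqR, hxq, -⟩ := hR.exists_dist_eq (t := min (dist x p) (dist x z))
      (le_min dist_nonneg dist_nonneg) (min_le_right _ _)
    have hq := hR.dist_add_dist hqR
    exact ⟨q, hqR, dist_le_of_slim hc hc hpx hq hxq (h x z p q hq)⟩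
  rcases h x y z p (hP.dist_add_dist hp) with h | h
  · obtain ⟨q, hq, hd⟩ := near hR.symm h
    exact ⟨q, Or.inr hq, hd⟩
  · obtain ⟨q, hq, hd⟩ := near hQ h
    exact ⟨q, Or.inl hq, hd⟩

theorem IsHyperbolicMetricSpace.exists_isSlimDist (h : IsHyperbolicMetricSpace M) :
    ∃ c : ℝ, 0 ≤ c ∧ IsSlimDist (dist : M → M → ℝ) c := by
  obtain ⟨hM, δ, hδ, h⟩ := h
  refine ⟨2 * δ, by linarith, fun x y z p hp => ?_⟩
  obtain ⟨P₁, hP₁⟩ := hM x p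
  obtain ⟨P₂, hP₂⟩ := hM p y
  obtain ⟨P, hP, hpP⟩ := hP₁.union hP₂ hp.le
  obtain ⟨Q, hQ⟩ := hM y z
  obtain ⟨R, hR⟩ := hM z x
  obtain ⟨q, hq | hq, hd⟩ := h x y z P Q R hP hQ hR p hpP
  · right
    have := hQ.dist_add_dist hq
    linarith [dist_triangle y q p, dist_triangle p q z, dist_comm p q]
  · left
    have := hR.dist_add_dist hq
    linarith [dist_triangle x q p, dist_triangle p q z, dist_comm p q, dist_comm z q,
      dist_comm q x, dist_comm z x]

end Geodesic

/-! ### Cayley complexes and word metrics -/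

namespace CayleyComplex

variable {G : Type*} [Group G] {S : Set G} (hS : Subgroup.closure S = ⊤)

/-- The point of the Cayley complex given by a vertex. -/
noncomputable def vertex (g : G) : CayleyComplex S hS :=
  SeparationQuotient.mk (CayleyCell.vertex g)

/-- The point of the Cayley complex at the parameter `t` of the edge `(g, s)`, where `t` is moved to
the nearest end of the unit interval if it lies outside. -/
noncomputable def edge (g : G) (s : S) (t : ℝ) : CayleyComplex S hS :=
  SeparationQuotient.mk (CayleyCell.edge g s (Set.projIcc 0 1 zero_le_one t))

theorem dist_vertex (u v : G) : dist (vertex hS u) (vertex hS v) = wordDist S u v := by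
  rw [vertex, vertex, SeparationQuotient.dist_mk]
  exact CayleyCell.vertexDist_comm v u

theorem dist_mk_vertex (p : CayleyCell S hS) (v : G) :
    dist (SeparationQuotient.mk p : CayleyComplex S hS) (vertex hS v) = p.distVertex v := by
  rw [vertex, SeparationQuotient.dist_mk, dist_comm]
  rfl

theorem vertex_eq_edge_zero (g : G) (s : S) : vertex hS g = edge hS g s 0 := by
  rw [edge, ← dist_eq_zero, dist_comm, dist_mk_vertex]
  simp only [CayleyCell.distVertex, Set.projIcc_left, CayleyCell.vertexDist_self]
  have : 0 ≤ cayleyVertexDist S (g * s) g := Nat.cast_nonneg _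
  simp [this, add_nonneg]

theorem vertex_eq_edge_one (g : G) (s : S) : vertex hS (g * s) = edge hS g s 1 := by
  rw [edge, ← dist_eq_zero, dist_comm, dist_mk_vertex]
  simp only [CayleyCell.distVertex, Set.projIcc_right, CayleyCell.vertexDist_self]
  have : 0 ≤ cayleyVertexDist S g (g * s) := Nat.cast_nonneg _
  simp [this, add_nonneg]

theorem exists_isGeodesicSegment_edge_of_le (g : G) (s : S) {a b : ℝ} (ha : 0 ≤ a) (hab : a ≤ b)
    (hb : b ≤ 1) (h : b - a ≤ dist (edge hS g s a) (edge hS g s b)) :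
    ∃ P, IsGeodesicSegment P (edge hS g s a) (edge hS g s b) := by
  refine ⟨_, isGeodesicSegment_of_dist_le (γ := fun t => edge hS g s (a + t)) (ℓ := b - a)
    (by linarith) (by simp) (by simp) (fun t u ht htu hu => ?_) h⟩
  rw [edge, edge, SeparationQuotient.dist_mk]
  refine (CayleyCell.pathDist_same_edge_le g s _ _).trans ?_
  rw [Set.projIcc_of_mem zero_le_one (x := a + t) ⟨by linarith, by linarith⟩,
    Set.projIcc_of_mem zero_le_one (x := a + u) ⟨by linarith, by linarith⟩]
  rw [abs_sub_comm, abs_of_nonneg] <;> dsimp only <;> linarith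

theorem exists_isGeodesicSegment_edge (g : G) (s : S) {a b : ℝ} (ha : a ∈ Set.Icc (0 : ℝ) 1)
    (hb : b ∈ Set.Icc (0 : ℝ) 1) (h : |a - b| ≤ dist (edge hS g s a) (edge hS g s b)) :
    ∃ P, IsGeodesicSegment P (edge hS g s a) (edge hS g s b) := by
  rcases le_total a b with hab | hab
  · exact exists_isGeodesicSegment_edge_of_le hS g s ha.1 hab hb.2
      ((neg_sub a b ▸ neg_le_abs _).trans h)
  · obtain ⟨P, hP⟩ := exists_isGeodesicSegment_edge_of_le hS g s hb.1 hab ha.2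
      (((le_abs_self _).trans h).trans (dist_comm _ _).le)
    exact ⟨P, hP.symm⟩

theorem exists_isGeodesicSegment_vertex (u v : G) :
    ∃ P, IsGeodesicSegment P (vertex hS u) (vertex hS v) := by
  induction hn : wordDist S u v generalizing u with
  | zero =>
    rw [eq_of_wordDist_eq_zero hS hn]
    exact ⟨_, isGeodesicSegment_singleton _⟩
  | succ n ih =>
    have huv : u ≠ v := by rintro rfl; simp [wordDist_self] at hn
    obtain ⟨w, hw, h⟩ := exists_wordDist_succ hS huv
    have huw : wordDist S u w = 1 := SimpleGraph.dist_eq_one_iff_adj.2 hw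
    have hd : dist (vertex hS u) (vertex hS w) = 1 := by rw [dist_vertex, huw, Nat.cast_one]
    obtain ⟨Q, hQ⟩ := ih w (by omega)
    obtain ⟨P, hP⟩ : ∃ P, IsGeodesicSegment P (vertex hS u) (vertex hS w) := by
      obtain ⟨-, s, hs, rfl | rfl⟩ := (SimpleGraph.mulCayley_adj' S u w).1 hw
      · rw [vertex_eq_edge_zero hS u ⟨s, hs⟩, vertex_eq_edge_one hS u ⟨s, hs⟩] at hd ⊢
        exact exists_isGeodesicSegment_edge hS _ _ (by simp) (by simp) (by rw [hd]; simp)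
      · rw [vertex_eq_edge_zero hS w ⟨s, hs⟩, vertex_eq_edge_one hS w ⟨s, hs⟩] at hd ⊢
        exact exists_isGeodesicSegment_edge hS _ _ (by simp) (by simp) (by rw [hd]; simp)
    obtain ⟨R, hR, -⟩ := hP.union hQ (by
      rw [dist_vertex, dist_vertex, dist_vertex]
      exact_mod_cast (by omega : wordDist S u w + wordDist S w v ≤ wordDist S u v))
    exact ⟨R, hR⟩

theorem mk_edge (g : G) (s : S) (t : unitInterval) :
    (SeparationQuotient.mk (CayleyCell.edge g s t) : CayleyComplex S hS) = edge hS g s t := by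
  rw [edge, Set.projIcc_val]

theorem exists_isGeodesicSegment_mk_vertex (p : CayleyCell S hS) (v : G) :
    ∃ P, IsGeodesicSegment P (SeparationQuotient.mk p : CayleyComplex S hS) (vertex hS v) := by
  cases p with
  | vertex u => exact exists_isGeodesicSegment_vertex hS u v
  | edge g s t =>
    have hd := dist_mk_vertex hS (.edge g s t) v
    rw [mk_edge] at hd ⊢
    -- `w` is the end of the edge, at the parameter `a`, through which a shortest path leaves
    have key : ∀ (a : ℝ) (w : G), a ∈ Set.Icc (0 : ℝ) 1 → vertex hS w = edge hS g s a →
        dist (edge hS g s t) (vertex hS v) = |(t : ℝ) - a| + wordDist S w v →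
        ∃ P, IsGeodesicSegment P (edge hS g s t) (vertex hS v) := by
      intro a w ha hw h
      have h1 : dist (edge hS g s t) (edge hS g s a) ≤ |(t : ℝ) - a| := by
        rw [edge, edge, SeparationQuotient.dist_mk]
        refine (CayleyCell.pathDist_same_edge_le g s _ _).trans ?_
        rw [Set.projIcc_val, Set.projIcc_of_mem _ ha]
      rw [← dist_vertex hS] at h
      have h2 := dist_triangle (edge hS g s t) (vertex hS w) (vertex hS v)
      obtain ⟨P, hP⟩ := exists_isGeodesicSegment_edge hS g s t.2 ha (by rw [← hw]; linarith)
      obtain ⟨Q, hQ⟩ := exists_isGeodesicSegment_vertex hS w v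
      rw [← hw] at hP h1
      obtain ⟨R, hR, -⟩ := hP.union hQ (by linarith)
      exact ⟨R, hR⟩
    simp only [CayleyCell.distVertex] at hd
    rcases min_choice ((t : ℝ) + cayleyVertexDist S g v)
      (1 - (t : ℝ) + cayleyVertexDist S (g * s) v) with h | h <;> rw [h] at hd
    · refine key 0 g (by simp) (vertex_eq_edge_zero hS g s) ?_
      rw [hd, sub_zero, abs_of_nonneg t.2.1]
      rfl
    · refine key 1 (g * s) (by simp) (vertex_eq_edge_one hS g s) ?_
      rw [hd, abs_sub_comm, abs_of_nonneg (sub_nonneg.2 t.2.2)]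
      rfl

theorem isGeodesicMetricSpace : IsGeodesicMetricSpace (CayleyComplex S hS) := by
  intro x y
  obtain ⟨p, rfl⟩ := SeparationQuotient.surjective_mk x
  obtain ⟨q, rfl⟩ := SeparationQuotient.surjective_mk y
  have hd : dist (SeparationQuotient.mk p : CayleyComplex S hS) (SeparationQuotient.mk q) =
    p.pathDist q := SeparationQuotient.dist_mk p q
  rcases CayleyCell.pathDist_cases p q with ⟨w, h⟩ | ⟨g, s, t, u, rfl, rfl, h⟩
  · obtain ⟨P, hP⟩ := exists_isGeodesicSegment_mk_vertex hS p w
    obtain ⟨Q, hQ⟩ := exists_isGeodesicSegment_mk_vertex hS q w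
    obtain ⟨R, hR, -⟩ := hP.union hQ.symm (by
      rwa [dist_comm (vertex hS w), dist_mk_vertex, dist_mk_vertex, hd])
    exact ⟨R, hR⟩
  · rw [mk_edge, mk_edge] at *
    exact exists_isGeodesicSegment_edge hS g s t.2 u.2 (by rw [hd, h])

theorem exists_dist_vertex_le_one (x : CayleyComplex S hS) : ∃ v, dist x (vertex hS v) ≤ 1 := by
  obtain ⟨p, rfl⟩ := SeparationQuotient.surjective_mk x
  cases p with
  | vertex g => exact ⟨g, (dist_self (vertex hS g)).trans_le zero_le_one⟩
  | edge g s t =>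
    refine ⟨g, ?_⟩
    rw [dist_mk_vertex]
    refine (min_le_left _ _).trans ?_
    rw [CayleyCell.vertexDist_self, add_zero]
    exact t.2.2

theorem isHyperbolic_of_isSlimDist {c : ℕ} (h : IsSlimDist (wordDist S) c) :
    IsHyperbolicMetricSpace (CayleyComplex S hS) := by
  refine isHyperbolicMetricSpace_of_isSlimDist (isGeodesicMetricSpace hS)
    (c := 3 * c + 20) (by positivity) fun x y z p hp => ?_
  obtain ⟨x', hx⟩ := exists_dist_vertex_le_one hS x
  obtain ⟨y', hy⟩ := exists_dist_vertex_le_one hS y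
  obtain ⟨z', hz⟩ := exists_dist_vertex_le_one hS z
  obtain ⟨p', hp'⟩ := exists_dist_vertex_le_one hS p
  have hv : ∀ x y z p, dist (vertex hS x) (vertex hS p) + dist (vertex hS p) (vertex hS y) =
      dist (vertex hS x) (vertex hS y) →
      dist (vertex hS x) (vertex hS p) + dist (vertex hS p) (vertex hS z) ≤
        dist (vertex hS x) (vertex hS z) + c ∨
      dist (vertex hS y) (vertex hS p) + dist (vertex hS p) (vertex hS z) ≤
        dist (vertex hS y) (vertex hS z) + c := by
    simp only [dist_vertex]
    exact_mod_cast h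
  obtain ⟨q', hq1, hq2⟩ := exists_wordDist_eq hS (u := x') (v := y')
    (n := min (wordDist S x' p') (wordDist S x' y')) (min_le_right _ _)
  have hq : dist (vertex hS x') (vertex hS q') + dist (vertex hS q') (vertex hS y') =
      dist (vertex hS x') (vertex hS y') := by
    simp only [dist_vertex]
    exact_mod_cast (by omega : wordDist S x' q' + wordDist S q' y' = wordDist S x' y')
  have hxq : dist (vertex hS x') (vertex hS q') =
      min (dist (vertex hS x') (vertex hS p')) (dist (vertex hS x') (vertex hS y')) := by
    simp only [dist_vertex]
    exact_mod_cast hq1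
  have perturb : ∀ {x y : CayleyComplex S hS} {x' y' : G}, dist x (vertex hS x') ≤ 1 →
      dist y (vertex hS y') ≤ 1 → dist x y ≤ dist (vertex hS x') (vertex hS y') + 2 ∧
        dist (vertex hS x') (vertex hS y') ≤ dist x y + 2 := by
    intro x y x' y' hx hy
    have h1 := dist_triangle4 x (vertex hS x') (vertex hS y') y
    have h2 := dist_triangle4 (vertex hS x') x y (vertex hS y')
    rw [dist_comm (vertex hS y') y] at h1
    rw [dist_comm (vertex hS x') x] at h2
    constructor <;> linarith
  have hpq : dist (vertex hS p') (vertex hS q') ≤ c + 6 :=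
    dist_le_of_slim (by positivity) (by norm_num)
      (by linarith [(perturb hx hp').2, (perturb hp' hy).2, (perturb hx hy).1]) hq hxq
      (hv x' y' p' q' hq)
  have t1 := dist_triangle (vertex hS p') (vertex hS q') (vertex hS z')
  have pz := (perturb hp' hz).1
  rcases hv x' y' z' q' hq with h | h
  · left
    have t2 := dist_triangle (vertex hS x') (vertex hS q') (vertex hS p')
    linarith [(perturb hx hp').1, (perturb hx hz).2, dist_comm (vertex hS q') (vertex hS p')]
  · right
    have t2 := dist_triangle (vertex hS y') (vertex hS q') (vertex hS p')
    linarith [(perturb hy hp').1, (perturb hy hz).2, dist_comm (vertex hS q') (vertex hS p')]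

theorem exists_isSlimDist_of_isHyperbolic (h : IsHyperbolicMetricSpace (CayleyComplex S hS)) :
    ∃ c : ℕ, IsSlimDist (wordDist S) c := by
  obtain ⟨c, -, h⟩ := h.exists_isSlimDist
  refine ⟨⌈c⌉₊, fun x y z p hp => ?_⟩
  have := h (vertex hS x) (vertex hS y) (vertex hS z) (vertex hS p) (by
    simp only [dist_vertex]; exact_mod_cast hp)
  simp only [dist_vertex] at this
  have hc := Nat.le_ceil c
  refine this.imp (fun h => ?_) fun h => ?_
  · exact_mod_cast h.trans (add_le_add_right hc _)
  · exact_mod_cast h.trans (add_le_add_right hc _)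

end CayleyComplex

/-! ### The normal form theorem for the amalgamated product -/

section PushoutCriterion

open Monoid

variable {G A : Type*} {F : Bool → Type*} [Group G] [Group A] [∀ b, Group (F b)]
  {φ : ∀ b, A →* F b} {P : Bool → Subgroup G} {θ : G →* PushoutI φ}

theorem StartsIn.exists_reduced
    (hθ : ∀ b, ∀ g ∈ P b, g ∉ P (!b) → ∃ x, x ∉ (φ b).range ∧ θ g = PushoutI.of b x)
    {b : Bool} {g : G} (h : StartsIn P b g) :
    ∃ w : CoprodI.Word F, PushoutI.Reduced φ w ∧ PushoutI.ofCoprodI w.prod = θ g ∧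
      w.fstIdx = some b := by
  have cons : ∀ {b : Bool} {g x : G} (w : CoprodI.Word F), g ∈ P b → g ∉ P (!b) →
      PushoutI.Reduced φ w → PushoutI.ofCoprodI w.prod = θ x → w.fstIdx ≠ some b →
      ∃ w : CoprodI.Word F, PushoutI.Reduced φ w ∧ PushoutI.ofCoprodI w.prod = θ (g * x) ∧
        w.fstIdx = some b := by
    intro b g x w hg hg' hw hwx hwb
    obtain ⟨y, hy, hgy⟩ := hθ b g hg hg'
    have hy1 : y ≠ 1 := by rintro rfl; exact hy (one_mem _)
    refine ⟨.cons y w hwb hy1, ?_, ?_, ?_⟩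
    · intro l hl
      rcases List.mem_cons.1 hl with rfl | hl
      · exact hy
      · exact hw l hl
    · rw [CoprodI.Word.prod_cons, map_mul, map_mul, PushoutI.ofCoprodI_of, hwx, hgy]
    · exact CoprodI.Word.fstIdx_cons _ _ _ _
  induction h with
  | @single b g hg hg' =>
    rw [← mul_one g]
    exact cons .empty hg hg' (fun _ h => by simp [CoprodI.Word.empty] at h) (by simp)
      (by simp [CoprodI.Word.empty, CoprodI.Word.fstIdx])
  | cons hg hg' _ ih =>
    obtain ⟨w, hw, hwx, hwb⟩ := ih
    exact cons w hg hg' hw hwx (by simp [hwb])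

/-- A group generated by two subgroups is their amalgamated product if it maps to a pushout in such
a way that elements outside the intersection map to letters outside the amalgamated subgroup: the
reduced words of the pushout keep alternating products apart. -/
theorem isInternalAmalgam_of_hom_pushout (hφ : ∀ b, Function.Injective (φ b))
    (hP : P true ⊔ P false = ⊤)
    (hθ : ∀ b, ∀ g ∈ P b, g ∉ P (!b) → ∃ x, x ∉ (φ b).range ∧ θ g = PushoutI.of b x)
    (hbase : ∀ g, (∀ b, g ∈ P b) → θ g ∈ (PushoutI.base φ).range) : IsInternalAmalgam P where
  sup_eq_top := hP
  not_startsIn_not {b g} h h' := by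
    obtain ⟨d⟩ := PushoutI.NormalWord.transversal_nonempty φ hφ
    obtain ⟨w, hw, hwg, hwb⟩ := h.exists_reduced hθ
    obtain ⟨w', hw', hwg', hwb'⟩ := h'.exists_reduced hθ
    obtain ⟨n, hn, hn'⟩ := hw.exists_normalWord_prod_eq d
    obtain ⟨m, hm, hm'⟩ := hw'.exists_normalWord_prod_eq d
    have hnm : n = m := PushoutI.NormalWord.prod_injective (by rw [hn, hm, hwg, hwg'])
    rw [hnm, hm'] at hn'
    rw [CoprodI.Word.fstIdx, ← List.head?_map] at hwb hwb'
    rw [← hn', hwb'] at hwb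
    exact Bool.not_ne_self b (Option.some.inj hwb)
  not_mem_inter {b g} h hg := by
    obtain ⟨w, hw, hwg, hwb⟩ := h.exists_reduced hθ
    rw [hw.eq_empty_of_mem_range hφ (hwg ▸ hbase g hg)] at hwb
    simp [CoprodI.Word.empty, CoprodI.Word.fstIdx] at hwb

end PushoutCriterion

namespace AmalgamatedProduct

open Monoid

universe u v

variable {H : Type u} {K : Type v} [Group H] [Group K] {A : Subgroup H} {B : Subgroup K}
  (μ : A ≃* B)

/-- The two factors, lifted to a common universe so that they form a family. -/
def Factor (H : Type u) (K : Type v) : Bool → Type (max u v)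
  | true => ULift.{v} H
  | false => ULift.{u} K

instance instGroupFactor : ∀ b, Group (Factor H K b)
  | true => inferInstanceAs (Group (ULift.{v} H))
  | false => inferInstanceAs (Group (ULift.{u} K))

/-- The inclusions of the amalgamated subgroup `A` in the two factors. -/
def toFactor : ∀ b, A →* Factor H K b
  | true => (MulEquiv.ulift.symm : H ≃* ULift.{v} H).toMonoidHom.comp A.subtype
  | false => ((MulEquiv.ulift.symm : K ≃* ULift.{u} K).toMonoidHom.comp B.subtype).comp
      μ.toMonoidHom

theorem toFactor_injective : ∀ b, Function.Injective (toFactor μ b)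
  | true => fun _ _ h => Subtype.ext (ULift.up_injective h)
  | false => fun _ _ h => μ.injective (Subtype.ext (ULift.up_injective h))

/-- The canonical map from the first factor to the pushout of the family of factors. -/
def pushoutInl : H →* PushoutI (toFactor μ) :=
  (PushoutI.of (φ := toFactor μ) true).comp
    (MulEquiv.ulift.symm : H ≃* ULift.{v} H).toMonoidHom

/-- The canonical map from the second factor to the pushout of the family of factors. -/
def pushoutInr : K →* PushoutI (toFactor μ) :=
  (PushoutI.of (φ := toFactor μ) false).comp
    (MulEquiv.ulift.symm : K ≃* ULift.{u} K).toMonoidHom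

theorem pushoutInl_coe (a : A) : pushoutInl μ a = PushoutI.base (toFactor μ) a :=
  PushoutI.of_apply_eq_base (toFactor μ) true a

theorem pushoutInr_coe (a : A) : pushoutInr μ (μ a) = PushoutI.base (toFactor μ) a :=
  PushoutI.of_apply_eq_base (toFactor μ) false a

/-- The comparison map from the amalgamated product, a quotient of the free product, to the
pushout. -/
def toPushout : AmalgamatedProduct μ →* PushoutI (toFactor μ) :=
  QuotientGroup.lift _ (Coprod.lift (pushoutInl μ) (pushoutInr μ)) <| by
    refine Subgroup.normalClosure_le_normal ?_
    rintro _ ⟨a, rfl⟩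
    simp [pushoutInl_coe, pushoutInr_coe]

theorem toPushout_inl (h : H) : toPushout μ (inl μ h) = pushoutInl μ h := rfl

theorem inl_injective : Function.Injective (inl μ) := fun _ _ h =>
  ULift.up_injective (PushoutI.of_injective (toFactor_injective μ) true
    (congrArg (toPushout μ) h))

theorem inr_injective : Function.Injective (inr μ) := fun _ _ h =>
  ULift.up_injective (PushoutI.of_injective (toFactor_injective μ) false
    (congrArg (toPushout μ) h))

theorem inl_coe_eq_inr (a : A) : inl μ a = inr μ (μ a) := by
  refine QuotientGroup.eq_iff_div_mem.2 (Subgroup.subset_normalClosure ⟨a, ?_⟩)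
  rw [div_eq_mul_inv]

/-- The images of the two factors. -/
def factorRange : Bool → Subgroup (AmalgamatedProduct μ)
  | true => (inl μ).range
  | false => (inr μ).range

theorem exists_of_inl_eq_inr {h : H} {k : K} (hk : inl μ h = inr μ k) : ∃ a : A, (a : H) = h := by
  have hmem : pushoutInl μ h ∈ (PushoutI.base (toFactor μ)).range := by
    rw [← PushoutI.inf_of_range_eq_base_range (toFactor_injective μ) Bool.false_ne_true.symm]
    exact ⟨⟨_, rfl⟩, ⟨⟨k⟩, (congrArg (toPushout μ) hk).symm⟩⟩
  obtain ⟨a, ha⟩ := hmem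
  rw [← pushoutInl_coe, ← toPushout_inl, ← toPushout_inl] at ha
  exact ⟨a, ULift.up_injective (PushoutI.of_injective (toFactor_injective μ) true ha)⟩

/-- The two factors meet exactly in the amalgamated subgroup. -/
theorem mem_map_iff (g : AmalgamatedProduct μ) :
    g ∈ A.map (inl μ) ↔ ∀ b, g ∈ factorRange μ b := by
  rw [Bool.forall_bool]
  constructor
  · rintro ⟨a, ha, rfl⟩
    exact ⟨⟨μ ⟨a, ha⟩, (inl_coe_eq_inr μ ⟨a, ha⟩).symm⟩, ⟨a, rfl⟩⟩
  · rintro ⟨⟨k, hk⟩, ⟨h, rfl⟩⟩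
    obtain ⟨a, rfl⟩ := exists_of_inl_eq_inr μ hk.symm
    exact ⟨a, a.2, rfl⟩

theorem map_inr_eq : B.map (inr μ) = A.map (inl μ) := by
  ext g
  constructor
  · rintro ⟨b, hb, rfl⟩
    refine ⟨μ.symm ⟨b, hb⟩, (μ.symm ⟨b, hb⟩).2, ?_⟩
    rw [inl_coe_eq_inr, MulEquiv.apply_symm_apply]
  · rintro ⟨a, ha, rfl⟩
    exact ⟨μ ⟨a, ha⟩, (μ ⟨a, ha⟩).2, (inl_coe_eq_inr μ ⟨a, ha⟩).symm⟩

theorem range_sup_range : (inl μ).range ⊔ (inr μ).range = ⊤ := by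
  rw [eq_top_iff]
  rintro ⟨g⟩ -
  induction g using Coprod.induction_on' with
  | one => exact one_mem _
  | inl_mul h g ih => exact mul_mem (Subgroup.mem_sup_left (MonoidHom.mem_range.2 ⟨h, rfl⟩)) ih
  | inr_mul k g ih => exact mul_mem (Subgroup.mem_sup_right (MonoidHom.mem_range.2 ⟨k, rfl⟩)) ih

theorem isInternalAmalgam : IsInternalAmalgam (factorRange μ) := by
  refine isInternalAmalgam_of_hom_pushout (toFactor_injective μ) (θ := toPushout μ)
    (range_sup_range μ) ?_ ?_
  · rintro (_ | _) _ ⟨g, rfl⟩ hg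
    · refine ⟨⟨g⟩, ?_, rfl⟩
      rintro ⟨a, ha⟩
      obtain rfl : μ a = g := ULift.up_injective ha
      exact hg ⟨a, inl_coe_eq_inr μ a⟩
    · refine ⟨⟨g⟩, ?_, rfl⟩
      rintro ⟨a, ha⟩
      obtain rfl : a = g := ULift.up_injective ha
      exact hg ⟨μ a, (inl_coe_eq_inr μ a).symm⟩
  · intro g hg
    obtain ⟨a, ha, rfl⟩ := (mem_map_iff μ g).2 hg
    exact ⟨⟨a, ha⟩, (pushoutInl_coe μ ⟨a, ha⟩).symm⟩

end AmalgamatedProduct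

/-! ### Weak relative hyperbolicity -/

section Weak

variable {G : Type*} [Group G]

theorem relativeGenerators_singleton (X : Set G) (Q : Subgroup G) :
    relativeGenerators X {Q} = X ∪ Q := by
  simp [relativeGenerators]

/-- In the combination theorem, the thin triangle condition on a vertex group may be checked in its
own word metric. -/
theorem IsInternalAmalgam.slim_of_isSlimDist {P : Bool → Subgroup G} (hP : IsInternalAmalgam P)
    {S : Set G} (hS : IsAdaptedGeneratingSet P S) {H : Type*} [Group H] {T : Set H}
    (hT : Subgroup.closure T = ⊤) {f : H →* G} (hf : Function.Injective f) {b : Bool}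
    (hrange : f.range = P b) (hTS : f '' T = S ∩ P b) {c C : ℕ} (hcC : c ≤ C)
    (h : IsSlimDist (wordDist T) c) :
    ∀ x ∈ P b, ∀ y ∈ P b, ∀ z ∈ P b, wordDist S x 1 + wordDist S 1 y = wordDist S x y →
      wordDist S x 1 + wordDist S 1 z ≤ wordDist S x z + C ∨
        wordDist S y 1 + wordDist S 1 z ≤ wordDist S y z + C := by
  rw [← hrange]
  rintro _ ⟨x, rfl⟩ _ ⟨y, rfl⟩ _ ⟨z, rfl⟩ hxy
  rw [← map_one f] at *
  simp only [hP.wordDist_map hS hT hf hrange hTS] at *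
  have := h x y z 1 hxy
  omega

end Weak

theorem theorem1p2 {H K : Type*} [Group H] [Group K] (A : Subgroup H) (B : Subgroup K)
    (μ : A ≃* B) :
    WeaklyHyperbolicRelativeTo
        ({(AmalgamatedProduct.inl μ).range, (AmalgamatedProduct.inr μ).range} :
          Set (Subgroup (AmalgamatedProduct μ))) ∧
      (WeaklyHyperbolicRelativeTo ({A} : Set (Subgroup H)) →
        WeaklyHyperbolicRelativeTo ({B} : Set (Subgroup K)) →
          WeaklyHyperbolicRelativeTo
            ({A.map (AmalgamatedProduct.inl μ)} : Set (Subgroup (AmalgamatedProduct μ)))) := by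
  have hP := AmalgamatedProduct.isInternalAmalgam μ
  constructor
  · have hmem : ∀ g, g ∈ relativeGenerators ∅ ({(AmalgamatedProduct.inl μ).range,
        (AmalgamatedProduct.inr μ).range} : Set (Subgroup (AmalgamatedProduct μ))) ↔
        ∃ b, g ∈ AmalgamatedProduct.factorRange μ b := by
      intro g
      simp [relativeGenerators, AmalgamatedProduct.factorRange, or_comm]
    generalize hSdef : relativeGenerators ∅ ({(AmalgamatedProduct.inl μ).range,
        (AmalgamatedProduct.inr μ).range} : Set (Subgroup (AmalgamatedProduct μ))) = S at hmem
    have hS : IsAdaptedGeneratingSet (AmalgamatedProduct.factorRange μ) S := by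
      refine ⟨?_, fun s hs => (hmem s).1 hs, fun g hg => (hmem g).2 ⟨true, hg true⟩⟩
      rw [eq_top_iff, ← hP.sup_eq_top, sup_le_iff]
      exact ⟨fun g hg => Subgroup.subset_closure ((hmem g).2 ⟨_, hg⟩),
        fun g hg => Subgroup.subset_closure ((hmem g).2 ⟨_, hg⟩)⟩
    subst hSdef
    refine ⟨∅, Set.finite_empty, hS.closure_eq_top,
      CayleyComplex.isHyperbolic_of_isSlimDist _ (hP.isSlimDist hS (c := 2) ?_)⟩
    -- the vertex groups consist of generators, so their diameter is at most `1`
    intro b x hx y hy z hz _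
    have h1 := wordDist_mul_le_one ((hmem x).2 ⟨b, hx⟩) 1
    have h2 := wordDist_mul_le_one ((hmem z).2 ⟨b, hz⟩) 1
    rw [one_mul, wordDist_comm] at h1
    rw [one_mul] at h2
    left; omega
  · rintro ⟨X, hXfin, hX, hXhyp⟩ ⟨Y, hYfin, hY, hYhyp⟩
    obtain ⟨c, hc⟩ := CayleyComplex.exists_isSlimDist_of_isHyperbolic hX hXhyp
    obtain ⟨d, hd⟩ := CayleyComplex.exists_isSlimDist_of_isHyperbolic hY hYhyp
    let i := AmalgamatedProduct.inl μ
    let j := AmalgamatedProduct.inr μ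
    set Z := i '' X ∪ j '' Y with hZ
    generalize hSdef : relativeGenerators Z {A.map i} = S
    generalize hTdef : relativeGenerators X {A} = T at *
    generalize hUdef : relativeGenerators Y {B} = U at *
    rw [relativeGenerators_singleton] at hSdef hTdef hUdef
    have hSu : S = i '' T ∪ j '' U := by
      have hB : j '' (B : Set K) = (A.map i : Set _) :=
        congrArg (SetLike.coe) (AmalgamatedProduct.map_inr_eq μ)
      rw [← hSdef, ← hTdef, ← hUdef, hZ, Set.image_union, Set.image_union, hB, Subgroup.coe_map]
      ext g
      simp only [Set.mem_union]
      tauto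
    have hcore : ∀ g, (∀ b, g ∈ AmalgamatedProduct.factorRange μ b) → g ∈ i '' T ∧ g ∈ j '' U := by
      intro g hg
      have hA := (AmalgamatedProduct.mem_map_iff μ g).2 hg
      have hB := hA
      rw [← AmalgamatedProduct.map_inr_eq] at hB
      obtain ⟨a, ha, h⟩ := hA
      obtain ⟨b, hb, h'⟩ := hB
      exact ⟨⟨a, hTdef ▸ Or.inr ha, h⟩, ⟨b, hUdef ▸ Or.inr hb, h'⟩⟩
    have hi : ∀ g ∈ i '' T, g ∈ AmalgamatedProduct.factorRange μ true := by
      rintro _ ⟨t, -, rfl⟩; exact ⟨t, rfl⟩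
    have hj : ∀ g ∈ j '' U, g ∈ AmalgamatedProduct.factorRange μ false := by
      rintro _ ⟨t, -, rfl⟩; exact ⟨t, rfl⟩
    have hS : IsAdaptedGeneratingSet (AmalgamatedProduct.factorRange μ) S := by
      refine ⟨?_, ?_, fun g hg => hSu ▸ Or.inl (hcore g hg).1⟩
      · rw [hSu, Subgroup.closure_union, ← MonoidHom.map_closure, ← MonoidHom.map_closure, hX, hY,
          ← MonoidHom.range_eq_map, ← MonoidHom.range_eq_map]
        exact hP.sup_eq_top
      · rw [hSu]
        rintro s (hs | hs)
        · exact ⟨true, hi s hs⟩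
        · exact ⟨false, hj s hs⟩
    have hTS : i '' T = S ∩ AmalgamatedProduct.factorRange μ true := by
      rw [hSu]
      refine Set.Subset.antisymm (fun g hg => ⟨Or.inl hg, hi g hg⟩) ?_
      rintro g ⟨hg | hg, hg'⟩
      · exact hg
      · exact (hcore g (Bool.forall_bool.2 ⟨hj g hg, hg'⟩)).1
    have hUS : j '' U = S ∩ AmalgamatedProduct.factorRange μ false := by
      rw [hSu]
      refine Set.Subset.antisymm (fun g hg => ⟨Or.inr hg, hj g hg⟩) ?_
      rintro g ⟨hg | hg, hg'⟩
      · exact (hcore g (Bool.forall_bool.2 ⟨hg', hi g hg⟩)).2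
      · exact hg
    refine ⟨Z, (hXfin.image i).union (hYfin.image j), ?_⟩
    rw [relativeGenerators_singleton, hSdef]
    refine ⟨hS.closure_eq_top,
      CayleyComplex.isHyperbolic_of_isSlimDist _ (hP.isSlimDist hS (c := max c d) ?_)⟩
    rintro (_ | _)
    · exact hP.slim_of_isSlimDist hS hY (AmalgamatedProduct.inr_injective μ) rfl hUS
        (le_max_right c d) hd
    · exact hP.slim_of_isSlimDist hS hX (AmalgamatedProduct.inl_injective μ) rfl hTS
        (le_max_left c d) hc
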